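/- Let $0\le k\le n$. Every polynomial $p\in\mathbb{R}[x_1,\ldots,x_n]$ can be written uniquely as $p=\sum_{\mu}\mu\,p_{\mu}$, where $\mu$ ranges over the monomials in $x_1,\ldots,x_k$ and $p_{\mu}\in\mathbb{R}[x_{k+1},\ldots,x_n]$. Let $\|p\|$ denote the square root of the sum of the squares of the coefficients of $p$. A homogeneous polynomial $p$ of degree $d$ is called *$\varepsilon$-concentrated on the first $k$ variables* if $$\sum_{\mu:\ \deg(\mu)<d}\ \max_{x\in\mathbb{R}^{n-k},\ \|x\|=1}p_{\mu}(x)^2\ \le\ \varepsilon\|p\|^2,$$ where the norm on $\mathbb{R}^{n-k}$ is the Euclidean norm and the maximum over the empty set (the case $k=n$) is $0$. **Theorem.** For each real $\varepsilon>0$ and each $d\in\mathbb{N}$ there exists $k_{d,\varepsilon}\in\mathbb{N}$ such that for each $n$ and each homogeneous polynomial $p\in\mathbb{R}[x_1,\ldots,x_n]$ of degree $d$, there exist an orthogonal matrix $U\in O(n)$ and an integer $k$ with $0\le k\le n$ and $k\le k_{d,\varepsilon}$ such that the polynomial $p(Ux)$ is $\varepsilon$-concentrated on the first $k$ variables. 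-/

import Mathlib

namespace PolyConc

/-- The indices of the first `k` of the `n` variables. -/
abbrev FirstVars (n k : ℕ) : Type := {i : Fin n // i.val < k}

/-- The indices of the remaining variables. -/
abbrev LastVars (n k : ℕ) : Type := {i : Fin n // ¬ i.val < k}

/-- The composition `p ∘ U`: the polynomial obtained from `p` by the linear substitution
`x_i ↦ ∑ j, U i j * x_j`. -/
noncomputable def linSubst {n : ℕ} (U : Matrix (Fin n) (Fin n) ℝ)
    (p : MvPolynomial (Fin n) ℝ) : MvPolynomial (Fin n) ℝ :=
  MvPolynomial.aeval (fun i => ∑ j, MvPolynomial.C (U i j) * MvPolynomial.X j) p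

/-- The square root of the sum of the squares of the coefficients of `p`. -/
noncomputable def coeffNorm {n : ℕ} (p : MvPolynomial (Fin n) ℝ) : ℝ :=
  Real.sqrt (∑ m ∈ p.support, p.coeff m ^ 2)

/-- The polynomial `p_μ` in the last `n - k` variables, where `p = ∑ μ, μ * p_μ` and `μ` ranges
over the monomials (given by their exponents) in the first `k` variables. -/
noncomputable def partCoeff {n : ℕ} (k : ℕ) (p : MvPolynomial (Fin n) ℝ)
    (μ : FirstVars n k →₀ ℕ) : MvPolynomial (LastVars n k) ℝ :=
  (MvPolynomial.sumAlgEquiv ℝ (FirstVars n k) (LastVars n k)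
    (MvPolynomial.rename (Equiv.sumCompl (fun i : Fin n => i.val < k)).symm p)).coeff μ

/-- The maximum of `q(x)^2` over the Euclidean unit sphere. It is the value `0` if there are no
variables, when the unit sphere is empty. -/
noncomputable def sphereMaxSq {ι : Type} [Fintype ι] (q : MvPolynomial ι ℝ) : ℝ :=
  ⨆ x : Metric.sphere (0 : EuclideanSpace ℝ ι) 1,
    (MvPolynomial.eval (fun i => (x : EuclideanSpace ℝ ι) i) q) ^ 2

/-- A polynomial `p`, homogeneous of degree `d`, is `ε`-concentrated on the first `k` variables.
The double sum runs over all monomials `μ` of degree `j < d` in the first `k` variables. -/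
def IsConcentrated {n : ℕ} (ε : ℝ) (d k : ℕ) (p : MvPolynomial (Fin n) ℝ) : Prop :=
  ∑ j ∈ Finset.range d,
      ∑ μ ∈ Finset.finsuppAntidiag (Finset.univ : Finset (FirstVars n k)) j,
        sphereMaxSq (partCoeff k p μ)
    ≤ ε * coeffNorm p ^ 2

end PolyConc

/-!
Write `p(x) = T(x, …, x)` with a symmetric `d`-linear form `T`, and let the energy of the first `k`
coordinates be the squared norm of `T` restricted to them. Rotations preserve the total `‖T‖²`,
which is at most the squared norm of `p` because `T` is symmetric.

The value `p_μ(x)` is the sum of the values of `T` on elementary tensors whose slots carry either a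
standard basis vector among the first `k` (as prescribed by `μ`) or `x`. There are at most
`(d + 1) ^ d` such tensors for each `μ`, and for unit vectors `x`, even chosen separately for each
`μ`, all of them together are orthonormal. If `p` is not `ε`-concentrated, choosing `x` to maximize
`p_μ ^ 2` therefore shows that `T` has more energy on their span than on the first `k` coordinates,
by at least `ε ‖T‖² / (d + 1) ^ d`. Only `(k + 1) ^ d * d` vectors occur in these tensors, so a
rotation moves their span into the first `(k + 1) ^ d * d` coordinates. As the energy never exceeds
`‖T‖²`, this can be repeated at most `(d + 1) ^ d / ε` times.
-/

namespace PolyConc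

open Finset MvPolynomial
open scoped Matrix

theorem exists_iterate_of_energy_increment {S R : Type*} [CommRing R] [LinearOrder R]
    [IsStrictOrderedRing R] {good : S → Prop} {energy : S → R} {size : S → ℕ} {g : ℕ → ℕ}
    (hg : Monotone g) {B δ : R} (hB : ∀ s, energy s ≤ B)
    (hstep : ∀ s, ¬ good s → ∃ t, size t ≤ g (size s) ∧ energy s + δ < energy t)
    (N : ℕ) (s : S) (hN : B ≤ energy s + (N + 1) * δ) :
    ∃ t, good t ∧ ∃ i ≤ N, size t ≤ g^[i] (size s) := by
  induction N generalizing s with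
  | zero =>
    refine ⟨s, ?_, 0, le_rfl, le_rfl⟩
    by_contra hs
    obtain ⟨t, -, ht⟩ := hstep s hs
    rw [Nat.cast_zero, zero_add, one_mul] at hN
    exact (hB t).not_gt (hN.trans_lt ht)
  | succ N ih =>
    by_cases hs : good s
    · exact ⟨s, hs, 0, Nat.zero_le _, le_rfl⟩
    · obtain ⟨t, hsize, ht⟩ := hstep s hs
      obtain ⟨u, hu, i, hi, hui⟩ := ih t (by push_cast at hN; linarith)
      exact ⟨u, hu, i + 1, Nat.succ_le_succ hi, hui.trans (hg.iterate i hsize)⟩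

section MultilinearForm

variable {R κ ι ι' : Type*} [CommSemiring R]

/-- Multilinear forms on `ι → R` with arguments indexed by `κ`. A homogeneous polynomial is
represented by such a form, so that a linear substitution acts on each argument separately. -/
abbrev MultilinearForm (R κ ι : Type*) [CommSemiring R] : Type _ :=
  MultilinearMap R (fun _ : κ => ι → R) R

namespace MultilinearForm

/-- The pullback of a multilinear form along a linear map, applied in every argument. -/
def comp (T : MultilinearForm R κ ι) (φ : (ι' → R) →ₗ[R] (ι → R)) : MultilinearForm R κ ι' :=
  T.compLinearMap fun _ => φ

/-- Symmetric multilinear forms. -/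
def IsSymm (T : MultilinearForm R κ ι) : Prop :=
  ∀ (e : Equiv.Perm κ) (v : κ → ι → R), T (v ∘ e) = T v

theorem IsSymm.comp {T : MultilinearForm R κ ι} (hT : T.IsSymm)
    (φ : (ι' → R) →ₗ[R] (ι → R)) : (T.comp φ).IsSymm :=
  fun e v => hT e fun i => φ (v i)

/-- The multilinear form with prescribed values on the standard basis vectors. -/
def ofEntries [Fintype κ] [DecidableEq κ] [Fintype ι] (t : (κ → ι) → R) : MultilinearForm R κ ι :=
  ∑ f, t f • (MultilinearMap.mkPiAlgebra R κ R).compLinearMap fun i => LinearMap.proj (f i)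

theorem ofEntries_apply [Fintype κ] [DecidableEq κ] [Fintype ι] (t : (κ → ι) → R) (v : κ → ι → R) :
    ofEntries t v = ∑ f, t f * ∏ i, v i (f i) := by
  simp [ofEntries]

theorem isSymm_ofEntries [Fintype κ] [DecidableEq κ] [Fintype ι] {t : (κ → ι) → R}
    (ht : ∀ (e : Equiv.Perm κ) (f : κ → ι), t (f ∘ e) = t f) : (ofEntries t).IsSymm := by
  intro e v
  simp only [ofEntries_apply]
  refine Fintype.sum_equiv (e.arrowCongr (Equiv.refl ι)) _ _ fun f => ?_
  change t f * ∏ i, v (e i) (f i) = t (f ∘ e.symm) * ∏ i, v i (f (e.symm i))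
  rw [ht, ← Equiv.prod_comp e fun i => v i (f (e.symm i))]
  simp only [Equiv.symm_apply_apply]

variable [DecidableEq ι]

/-- The values of a multilinear form on the standard basis vectors. -/
def entry (T : MultilinearForm R κ ι) (f : κ → ι) : R :=
  T fun i => Pi.single (f i) 1

theorem IsSymm.entry_comp {T : MultilinearForm R κ ι} (hT : T.IsSymm) (e : Equiv.Perm κ)
    (f : κ → ι) : T.entry (f ∘ e) = T.entry f :=
  hT e fun i => Pi.single (f i) 1

variable [Fintype κ]

theorem apply_eq_sum_entry [Fintype ι] [DecidableEq κ] (T : MultilinearForm R κ ι)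
    (v : κ → ι → R) : T v = ∑ f, T.entry f * ∏ i, v i (f i) := by
  calc T v = T fun i => ∑ j, v i j • Pi.single j 1 := by simp only [← pi_eq_sum_univ']
    _ = ∑ f : κ → ι, T fun i => v i (f i) • Pi.single (f i) 1 := T.map_sum _
    _ = ∑ f, T.entry f * ∏ i, v i (f i) := sum_congr rfl fun f _ => by
      rw [T.map_smul_univ, smul_eq_mul, mul_comm, entry]

theorem prod_single_apply (f g : κ → ι) :
    ∏ i, (Pi.single (f i) 1 : ι → R) (g i) = if g = f then 1 else 0 := by
  simp only [Pi.single_apply, prod_ite_zero, mem_univ, true_imp_iff, prod_const_one, funext_iff]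

theorem entry_ofEntries [Fintype ι] [DecidableEq κ] (t : (κ → ι) → R) (f : κ → ι) :
    (ofEntries t).entry f = t f := by
  simp [entry, ofEntries_apply, prod_single_apply]

end MultilinearForm

end MultilinearForm

section Exponent

variable {κ σ : Type*} [Fintype κ]

/-- The exponent of the monomial `∏ i, X (f i)`. -/
noncomputable def exponent (f : κ → σ) : σ →₀ ℕ := ∑ i, Finsupp.single (f i) 1

theorem prod_X_eq_monomial_exponent {R : Type*} [CommSemiring R] (f : κ → σ) :
    (∏ i, X (f i) : MvPolynomial σ R) = monomial (exponent f) 1 := by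
  simp only [X, exponent, monomial_sum_one]

theorem exponent_apply [DecidableEq σ] (f : κ → σ) (c : σ) : exponent f c = #{i | f i = c} := by
  simp [exponent, Finsupp.finsetSum_apply, Finsupp.single_apply]

theorem degree_exponent (f : κ → σ) : (exponent f).degree = Fintype.card κ := by
  simp [exponent, map_sum]

theorem exponent_comp_perm (f : κ → σ) (e : Equiv.Perm κ) : exponent (f ∘ e) = exponent f :=
  Equiv.sum_comp e fun i => Finsupp.single (f i) 1

theorem exists_perm_of_exponent_eq {f g : κ → σ} (h : exponent f = exponent g) :
    ∃ e : Equiv.Perm κ, f = g ∘ e := by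
  classical
  have fiberEquiv (c : σ) : Nonempty ({i // f i = c} ≃ {i // g i = c}) := by
    rw [← Fintype.card_eq, Fintype.card_subtype, Fintype.card_subtype]
    simpa only [exponent_apply] using DFunLike.congr_fun h c
  exact ⟨Equiv.ofFiberEquiv fun c => (fiberEquiv c).some,
    funext fun i => (Equiv.ofFiberEquiv_map _ i).symm⟩

theorem exists_exponent_eq {m : σ →₀ ℕ} (hm : m.degree = Fintype.card κ) :
    ∃ f : κ → σ, exponent f = m := by
  classical
  have hcard : Fintype.card κ = Fintype.card m.toMultiset := by
    rw [Multiset.card_coe, Finsupp.card_toMultiset, ← hm]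
    rfl
  let e : κ ≃ m.toMultiset := Fintype.equivOfCardEq hcard
  refine ⟨fun i => (e i).1, Multiset.toFinsupp.symm.injective ?_⟩
  calc Finsupp.toMultiset (exponent fun i => (e i).1) = ∑ i, {(e i).1} := by
        simp [exponent, map_sum]
    _ = ∑ x : m.toMultiset, {(x : σ)} := Equiv.sum_comp e fun x => ({(x : σ)} : Multiset σ)
    _ = (m.toMultiset.map singleton).sum := congrArg Multiset.sum (Multiset.map_univ _ singleton)
    _ = m.toMultiset := Multiset.sum_map_singleton _

end Exponent

section Pattern

variable {κ S : Type*} [Fintype κ]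

theorem exponent_none_add_degree_some (α : κ → Option S) :
    exponent α none + (exponent α).some.degree = Fintype.card κ := by
  rw [← degree_exponent α]
  exact (Finsupp.sum_option_index (exponent α) (fun _ a => a) (fun _ => rfl)
    fun _ _ _ => rfl).symm

theorem degree_exponent_some_lt_iff (α : κ → Option S) :
    (exponent α).some.degree < Fintype.card κ ↔ exponent α none ≠ 0 := by
  rw [← exponent_none_add_degree_some α, lt_add_iff_pos_left, Nat.pos_iff_ne_zero]

theorem exponent_none_eq_zero_iff (α : κ → Option S) :
    exponent α none = 0 ↔ ∀ i, (α i).isSome := by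
  classical
  simp [exponent_apply, filter_eq_empty_iff, Option.isSome_iff_ne_none]

theorem card_exponent_some_eq_le [Fintype S] [DecidableEq S] [DecidableEq κ] (μ : S →₀ ℕ) :
    #{α : κ → Option S | (exponent α).some = μ} ≤ (#μ.support + 1) ^ Fintype.card κ := by
  calc #{α : κ → Option S | (exponent α).some = μ}
      ≤ #(Fintype.piFinset fun _ : κ => insertNone μ.support) := by
        refine card_le_card fun α hα => Fintype.mem_piFinset.2 fun i => mem_insertNone.2 ?_
        rintro a (ha : α i = some a)
        rw [← (mem_filter.1 hα).2, Finsupp.mem_support_iff, Finsupp.some_apply, exponent_apply]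
        exact card_ne_zero_of_mem (mem_filter.2 ⟨mem_univ i, ha⟩)
    _ = (#μ.support + 1) ^ Fintype.card κ := by simp

theorem card_support_le_degree {σ : Type*} (μ : σ →₀ ℕ) : #μ.support ≤ μ.degree := by
  rw [Finsupp.degree_apply]
  simpa using card_nsmul_le_sum μ.support μ 1 fun a ha =>
    Nat.one_le_iff_ne_zero.2 (Finsupp.mem_support_iff.1 ha)

theorem sum_sq_sum_exponent_some_le [Fintype S] [DecidableEq S] [DecidableEq κ]
    {R : Type*} [CommRing R] [LinearOrder R] [IsStrictOrderedRing R] (G : (κ → Option S) → R) :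
    ∑ j ∈ range (Fintype.card κ), ∑ μ ∈ finsuppAntidiag (univ : Finset S) j,
        (∑ α with (exponent α).some = μ, G α) ^ 2 ≤
      (Fintype.card κ + 1) ^ Fintype.card κ * ∑ α with exponent α none ≠ 0, G α ^ 2 := by
  have hμ : ∀ j ∈ range (Fintype.card κ), ∀ μ ∈ finsuppAntidiag (univ : Finset S) j,
      (∑ α with (exponent α).some = μ, G α) ^ 2 ≤
        (Fintype.card κ + 1) ^ Fintype.card κ * ∑ α with (exponent α).some = μ, G α ^ 2 := by
    intro j hj μ hμ
    refine sq_sum_le_card_mul_sum_sq.trans ?_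
    have hdeg : μ.degree = j := by
      rw [Finsupp.degree_eq_sum]
      exact (mem_finsuppAntidiag.1 hμ).1
    have hsupp : #μ.support ≤ Fintype.card κ :=
      (card_support_le_degree μ).trans (hdeg.trans_le (mem_range.1 hj).le)
    gcongr
    exact_mod_cast (card_exponent_some_eq_le μ).trans (by gcongr)
  refine (sum_le_sum fun j hj => sum_le_sum (hμ j hj)).trans_eq ?_
  simp only [← mul_sum]
  congr 1
  simp only [← degree_exponent_some_lt_iff, sum_filter]
  rw [sum_congr rfl fun j _ => sum_comm, sum_comm]
  refine sum_congr rfl fun α _ => ?_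
  simp [mem_finsuppAntidiag, ← Finsupp.degree_eq_sum]

theorem sum_comp_some_add_sum_exponent_none_ne_zero {M : Type*} [AddCommMonoid M] [Fintype S]
    [DecidableEq κ] (F : (κ → Option S) → M) :
    ∑ f : κ → S, F (some ∘ f) + ∑ α with exponent α none ≠ 0, F α = ∑ α, F α := by
  rw [← sum_filter_add_sum_filter_not univ fun α : κ → Option S => exponent α none = 0]
  congr 1
  refine sum_bij' (fun f _ => some ∘ f)
    (fun α hα i => (α i).get ((exponent_none_eq_zero_iff α).1 (mem_filter.1 hα).2 i))
    ?_ ?_ ?_ ?_ ?_ <;> simp [funext_iff, exponent_none_eq_zero_iff]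

end Pattern

section ToPoly

open MultilinearForm

variable {R κ ι : Type*} [Fintype κ] [Fintype ι] [DecidableEq ι]

/-- The homogeneous polynomial `x ↦ T (x, …, x)` of a multilinear form `T`. -/
noncomputable def MultilinearForm.toPoly [CommSemiring R] [DecidableEq κ]
    (T : MultilinearForm R κ ι) : MvPolynomial ι R :=
  ∑ f, C (T.entry f) * ∏ i, X (f i)

variable [DecidableEq κ]

theorem MultilinearForm.coeff_toPoly [CommSemiring R] (T : MultilinearForm R κ ι) (m : ι →₀ ℕ) :
    T.toPoly.coeff m = ∑ f with exponent f = m, T.entry f := by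
  simp only [toPoly, coeff_sum, prod_X_eq_monomial_exponent, coeff_C_mul, coeff_monomial,
    mul_ite, mul_one, mul_zero, sum_filter]

theorem MultilinearForm.aeval_mulVec_toPoly {ι' : Type*} [Fintype ι'] [DecidableEq ι']
    [CommSemiring R] (A : Matrix ι ι' R) (T : MultilinearForm R κ ι) :
    aeval (fun i => ∑ j, C (A i j) * X j) T.toPoly = (T.comp A.mulVecLin).toPoly := by
  have hentry (g : κ → ι') :
      (T.comp A.mulVecLin).entry g = ∑ f, T.entry f * ∏ i, A (f i) (g i) := by
    change T (fun i => A *ᵥ Pi.single (g i) 1) = _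
    rw [apply_eq_sum_entry]
    simp
  have hprod (f : κ → ι) : ∏ i, ∑ j, C (A (f i) j) * X j =
      ∑ g : κ → ι', C (∏ i, A (f i) (g i)) * ∏ i, X (g i) := by
    simp only [prod_univ_sum, Fintype.piFinset_univ, prod_mul_distrib, map_prod]
  simp only [toPoly, hentry, map_sum, map_mul, map_prod, aeval_X, aeval_C, algebraMap_eq, hprod,
    mul_sum, sum_mul, mul_assoc]
  exact sum_comm

theorem MultilinearForm.exists_isSymm_toPoly_eq {K : Type*} [Field K] [CharZero K]
    {p : MvPolynomial ι K} (hp : p.IsHomogeneous (Fintype.card κ)) :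
    ∃ T : MultilinearForm K κ ι, T.IsSymm ∧ T.toPoly = p := by
  refine ⟨ofEntries fun f => p.coeff (exponent f) / #{g : κ → ι | exponent g = exponent f},
    isSymm_ofEntries fun e f => by simp only [exponent_comp_perm], ?_⟩
  ext m
  simp only [coeff_toPoly, entry_ofEntries]
  by_cases hm : m.degree = Fintype.card κ
  · obtain ⟨f, hf⟩ := exists_exponent_eq hm
    have hcard : (#{g : κ → ι | exponent g = m} : K) ≠ 0 :=
      Nat.cast_ne_zero.2 (card_ne_zero_of_mem (mem_filter.2 ⟨mem_univ f, hf⟩))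
    rw [sum_congr rfl (g := fun _ => p.coeff m / #{g : κ → ι | exponent g = m})
      fun g hg => by rw [(mem_filter.1 hg).2], sum_const, nsmul_eq_mul, mul_div_cancel₀ _ hcard]
  · rw [hp.coeff_eq_zero hm, filter_false_of_mem, sum_empty]
    rintro f - rfl
    exact hm (degree_exponent f)

end ToPoly

section Orthogonal

variable {R κ ι : Type*} [CommRing R] [Fintype ι] [DecidableEq ι]

theorem mulVec_dotProduct_mulVec_of_mem_orthogonalGroup {U : Matrix ι ι R}
    (hU : U ∈ Matrix.orthogonalGroup ι R) (u v : ι → R) :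
    U *ᵥ u ⬝ᵥ U *ᵥ v = u ⬝ᵥ v := by
  rw [← Matrix.vecMul_transpose, ← Matrix.dotProduct_mulVec, Matrix.mulVec_mulVec,
    (Matrix.mem_orthogonalGroup_iff' _ _).1 hU, Matrix.one_mulVec]

theorem transpose_mem_orthogonalGroup {U : Matrix ι ι R}
    (hU : U ∈ Matrix.orthogonalGroup ι R) : Uᵀ ∈ Matrix.orthogonalGroup ι R :=
  (Matrix.mem_orthogonalGroup_iff' _ _).2 ((Matrix.mem_orthogonalGroup_iff _ _).1 hU)

theorem MultilinearForm.comp_mulVecLin_apply_transpose_mulVec (T : MultilinearForm R κ ι)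
    {U : Matrix ι ι R} (hU : U ∈ Matrix.orthogonalGroup ι R) (v : κ → ι → R) :
    T.comp U.mulVecLin (fun i => Uᵀ *ᵥ v i) = T v := by
  change T (fun i => U *ᵥ Uᵀ *ᵥ v i) = T v
  simp only [Matrix.mulVec_mulVec, (Matrix.mem_orthogonalGroup_iff _ _).1 hU, Matrix.one_mulVec]

end Orthogonal

section Frobenius

open MultilinearForm

variable {R κ ι ι' : Type*} [Fintype κ] [DecidableEq κ] [Fintype ι] [DecidableEq ι]

/-- The squared Frobenius (Hilbert–Schmidt) norm of a multilinear form. -/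
def MultilinearForm.frobeniusSq [CommSemiring R] (T : MultilinearForm R κ ι) : R :=
  ∑ f, T.entry f ^ 2

theorem MultilinearForm.frobeniusSq_nonneg [CommRing R] [LinearOrder R] [IsStrictOrderedRing R]
    (T : MultilinearForm R κ ι) : 0 ≤ T.frobeniusSq :=
  sum_nonneg fun _ _ => sq_nonneg _

theorem MultilinearForm.IsSymm.frobeniusSq_le [CommRing R] [LinearOrder R] [IsStrictOrderedRing R]
    {T : MultilinearForm R κ ι} (hT : T.IsSymm) :
    T.frobeniusSq ≤ ∑ m ∈ T.toPoly.support, T.toPoly.coeff m ^ 2 := by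
  have hfiber (m : ι →₀ ℕ) : ∑ f with exponent f = m, T.entry f ^ 2 ≤ T.toPoly.coeff m ^ 2 := by
    rw [coeff_toPoly]
    rcases eq_empty_or_nonempty {f : κ → ι | exponent f = m} with hm | ⟨g, hg⟩
    · simp [hm]
    have hconst : ∀ f ∈ ({f : κ → ι | exponent f = m} : Finset _), T.entry f = T.entry g := by
      intro f hf
      obtain ⟨e, rfl⟩ := exists_perm_of_exponent_eq
        ((mem_filter.1 hf).2.trans (mem_filter.1 hg).2.symm)
      exact hT.entry_comp e g
    have hcard : (1 : R) ≤ #{f : κ → ι | exponent f = m} := by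
      exact_mod_cast card_pos.2 ⟨g, hg⟩
    rw [sum_congr rfl hconst, sum_congr rfl fun f hf => by rw [hconst f hf], sum_const, sum_const,
      nsmul_eq_mul, nsmul_eq_mul, mul_pow]
    gcongr
    exact le_self_pow₀ hcard two_ne_zero
  calc T.frobeniusSq
      = ∑ m ∈ univ.image (exponent : (κ → ι) → _), ∑ f with exponent f = m, T.entry f ^ 2 :=
        (sum_fiberwise_of_maps_to (fun f _ => mem_image_of_mem _ (mem_univ f)) _).symm
    _ ≤ ∑ m ∈ univ.image (exponent : (κ → ι) → _), T.toPoly.coeff m ^ 2 :=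
        sum_le_sum fun m _ => hfiber m
    _ ≤ ∑ m ∈ T.toPoly.support, T.toPoly.coeff m ^ 2 := by
        rw [← sum_filter_of_ne (p := fun m => T.toPoly.coeff m ≠ 0)
          fun m _ h h0 => h (by simp [h0])]
        exact sum_le_sum_of_subset_of_nonneg
          (fun m hm => mem_support_iff.2 (mem_filter.1 hm).2) fun _ _ _ => sq_nonneg _

theorem sum_sq_dotProduct_le {Φ α : Type*} [Fintype Φ] [Fintype α] [DecidableEq α] (u : Φ → ℝ)
    (w : α → Φ → ℝ) (hw : ∀ a b, w a ⬝ᵥ w b = if a = b then 1 else 0) :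
    ∑ a, (u ⬝ᵥ w a) ^ 2 ≤ u ⬝ᵥ u := by
  have horth : Orthonormal ℝ fun a => (WithLp.toLp 2 (w a) : EuclideanSpace ℝ Φ) := by
    rw [orthonormal_iff_ite]
    intro a b
    rw [EuclideanSpace.inner_toLp_toLp, star_trivial, dotProduct_comm, hw]
  have hbessel := horth.sum_inner_products_le (WithLp.toLp 2 u) (s := univ)
  rw [EuclideanSpace.real_norm_sq_eq] at hbessel
  simpa [EuclideanSpace.inner_toLp_toLp, dotProduct, sq] using hbessel

theorem MultilinearForm.sum_sq_apply_le_frobeniusSq {α : Type*} [Fintype α] [DecidableEq α]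
    (T : MultilinearForm ℝ κ ι) (v : α → κ → ι → ℝ)
    (hv : ∀ a b, ∏ i, v a i ⬝ᵥ v b i = if a = b then 1 else 0) :
    ∑ a, T (v a) ^ 2 ≤ T.frobeniusSq := by
  have hdot (a b : α) :
      (fun f : κ → ι => ∏ i, v a i (f i)) ⬝ᵥ (fun f => ∏ i, v b i (f i)) =
        ∏ i, v a i ⬝ᵥ v b i := by
    simp only [dotProduct, prod_univ_sum, Fintype.piFinset_univ, prod_mul_distrib]
  have hbessel := sum_sq_dotProduct_le T.entry (fun a f => ∏ i, v a i (f i))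
    fun a b => (hdot a b).trans (hv a b)
  simpa only [apply_eq_sum_entry, frobeniusSq, dotProduct, ← sq] using hbessel

theorem MultilinearForm.frobeniusSq_comp_le [Fintype ι'] [DecidableEq ι']
    (T : MultilinearForm ℝ κ ι) {φ : (ι' → ℝ) →ₗ[ℝ] (ι → ℝ)} (hφ : ∀ u v, φ u ⬝ᵥ φ v = u ⬝ᵥ v) :
    (T.comp φ).frobeniusSq ≤ T.frobeniusSq := by
  refine sum_sq_apply_le_frobeniusSq T (fun (f : κ → ι') i => φ (Pi.single (f i) 1)) fun f g => ?_
  simp only [hφ, single_dotProduct, one_mul, prod_single_apply]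

theorem MultilinearForm.frobeniusSq_comp_mulVecLin (T : MultilinearForm ℝ κ ι) {U : Matrix ι ι ℝ}
    (hU : U ∈ Matrix.orthogonalGroup ι ℝ) :
    (T.comp U.mulVecLin).frobeniusSq = T.frobeniusSq := by
  refine le_antisymm
    (frobeniusSq_comp_le T (mulVec_dotProduct_mulVec_of_mem_orthogonalGroup hU)) ?_
  calc T.frobeniusSq = ((T.comp U.mulVecLin).comp Uᵀ.mulVecLin).frobeniusSq :=
        congrArg frobeniusSq
          (MultilinearMap.ext (T.comp_mulVecLin_apply_transpose_mulVec hU)).symm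
    _ ≤ (T.comp U.mulVecLin).frobeniusSq := frobeniusSq_comp_le _
        (mulVec_dotProduct_mulVec_of_mem_orthogonalGroup (transpose_mem_orthogonalGroup hU))

end Frobenius

section Energy

open MultilinearForm

variable {R κ ι : Type*}

theorem extend_val_dotProduct [Fintype ι] [CommSemiring R] {P : ι → Prop} [DecidablePred P]
    (u : {j // P j} → R) (w : ι → R) :
    Function.extend Subtype.val u 0 ⬝ᵥ w = u ⬝ᵥ fun j => w j := by
  refine (Fintype.sum_of_injective _ Subtype.val_injective _ _ (fun j hj => ?_) fun j => ?_).symm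
  · rw [Function.extend_apply' _ _ _ hj, Pi.zero_apply, zero_mul]
  · rw [Subtype.val_injective.extend_apply]

theorem extend_val_eq_self {M : Type*} [Zero M] {P : ι → Prop} {v : ι → M}
    (hv : ∀ j, ¬ P j → v j = 0) :
    Function.extend Subtype.val (fun j : {j // P j} => v j) 0 = v := by
  funext j
  by_cases hj : P j
  · exact Subtype.val_injective.extend_apply _ _ ⟨j, hj⟩
  · rw [Function.extend_apply' _ _ _ (by rintro ⟨i, rfl⟩; exact hj i.2), hv j hj, Pi.zero_apply]

theorem extend_val_single [DecidableEq ι] {M : Type*} [Zero M] {P : ι → Prop}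
    (j : {j // P j}) (c : M) :
    Function.extend Subtype.val (Pi.single j c) 0 = Pi.single (j : ι) c := by
  rw [← extend_val_eq_self (P := P) (v := Pi.single (j : ι) c) fun i hi =>
    Pi.single_eq_of_ne (M := fun _ => M) (fun h : i = j => hi (h ▸ j.2)) c]
  congr 1
  funext i
  simp only [Pi.single_apply, Subtype.ext_iff]

variable [Fintype κ] [DecidableEq κ] [Fintype ι] [DecidableEq ι] (P : ι → Prop) [DecidablePred P]

/-- The squared norm of the restriction of `T` to the coordinate subspace of the vectors
supported on `P`: the part of `T` that the coordinates satisfying `P` capture. -/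
def MultilinearForm.energy [CommSemiring R] (T : MultilinearForm R κ ι) : R :=
  ∑ f : κ → {j // P j}, T.entry (fun i => f i) ^ 2

theorem MultilinearForm.energy_nonneg [CommRing R] [LinearOrder R] [IsStrictOrderedRing R]
    (T : MultilinearForm R κ ι) : 0 ≤ T.energy P :=
  sum_nonneg fun _ _ => sq_nonneg _

theorem MultilinearForm.energy_eq_frobeniusSq_comp [CommSemiring R] (T : MultilinearForm R κ ι) :
    T.energy P =
      (T.comp (Function.ExtendByZero.linearMap R (Subtype.val : {j // P j} → ι))).frobeniusSq := by
  refine sum_congr rfl fun f _ => congrArg (fun v => T v ^ 2) (funext fun i => ?_)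
  exact (extend_val_single (f i) 1).symm

theorem MultilinearForm.energy_le_frobeniusSq (T : MultilinearForm ℝ κ ι) :
    T.energy P ≤ T.frobeniusSq := by
  rw [energy_eq_frobeniusSq_comp]
  refine frobeniusSq_comp_le T fun u v => ?_
  refine (extend_val_dotProduct u _).trans (congrArg (u ⬝ᵥ ·) (funext fun j => ?_))
  exact Subtype.val_injective.extend_apply v 0 j

variable {P}

theorem MultilinearForm.sum_sq_apply_le_energy {α : Type*} [Fintype α] [DecidableEq α]
    (T : MultilinearForm ℝ κ ι) {v : α → κ → ι → ℝ} (hP : ∀ a i j, ¬ P j → v a i j = 0)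
    (hv : ∀ a b, ∏ i, v a i ⬝ᵥ v b i = if a = b then 1 else 0) :
    ∑ a, T (v a) ^ 2 ≤ T.energy P := by
  have hext (a : α) (i : κ) := extend_val_eq_self (hP a i)
  rw [energy_eq_frobeniusSq_comp]
  calc ∑ a, T (v a) ^ 2 = ∑ a, (T.comp (Function.ExtendByZero.linearMap ℝ Subtype.val)
        fun i (j : {j // P j}) => v a i j) ^ 2 :=
        sum_congr rfl fun a _ => congrArg (fun w => T w ^ 2) (funext fun i => (hext a i).symm)
    _ ≤ _ := sum_sq_apply_le_frobeniusSq _ _ fun a b => by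
        simp only [← hv, ← extend_val_dotProduct, hext]

end Energy

section PatternVector

open MultilinearForm

variable {R κ ι : Type*} {P : ι → Prop} [DecidablePred P]

/-- The index `j` itself if `P j`, and `none` otherwise. A map `κ → Option {i // P i}` is called
a pattern; the pattern of `f : κ → ι` records the values of `f` that satisfy `P`. -/
def headIndex (P : ι → Prop) [DecidablePred P] (j : ι) : Option {i // P i} :=
  if h : P j then some ⟨j, h⟩ else none

/-- The factor that the variable with index `j` contributes to a coefficient `p_μ`, when the
variables not satisfying `P` take the values `x`: it is `1` for a variable of the monomial `μ`. -/
def tailFactor [One R] (x : {j // ¬ P j} → R) (j : ι) : R :=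
  if h : P j then 1 else x ⟨j, h⟩

theorem exponent_some_eq_sum {S : Type*} [Fintype κ] (α : κ → Option S) :
    (exponent α).some = ∑ i, (Finsupp.single (α i) 1).some := by
  ext a
  simp [exponent, Finsupp.finsetSum_apply]

theorem sumAlgEquiv_rename_X [CommSemiring R] (j : ι) :
    sumAlgEquiv R {i // P i} {i // ¬ P i} (rename (Equiv.sumCompl P).symm (X j)) =
      monomial (Finsupp.single (headIndex P j) 1).some (tailFactor X j) := by
  rw [rename_X]
  by_cases hj : P j
  · rw [Equiv.sumCompl_symm_apply_of_pos hj, sumAlgEquiv_X_inl]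
    simp [headIndex, tailFactor, hj, X]
  · rw [Equiv.sumCompl_symm_apply_of_neg hj, sumAlgEquiv_X_inr]
    simp [headIndex, tailFactor, hj]

theorem eval_tailFactor_X [CommSemiring R] (x : {j // ¬ P j} → R) (j : ι) :
    eval x (tailFactor X j) = tailFactor x j := by
  unfold tailFactor
  split_ifs <;> simp

variable [DecidableEq ι]

/-- The standard basis vector for `some j`, and the extension of `x` by zero for `none`.
The value `p_μ(x)` is a sum of values of the form representing `p` at tuples of such vectors. -/
def patternVector [Zero R] [One R] (x : {j // ¬ P j} → R) (o : Option {i // P i}) (j : ι) : R :=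
  if headIndex P j = o then tailFactor x j else 0

theorem MultilinearForm.eval_coeff_sumAlgEquiv_rename_toPoly [CommSemiring R] [Fintype κ]
    [DecidableEq κ] [Fintype ι] (T : MultilinearForm R κ ι) (μ : {i // P i} →₀ ℕ)
    (x : {j // ¬ P j} → R) :
    eval x ((sumAlgEquiv R {i // P i} {i // ¬ P i}
        (rename (Equiv.sumCompl P).symm T.toPoly)).coeff μ) =
      ∑ α with (exponent α).some = μ, T fun i => patternVector x (α i) := by
  have hpoly (f : κ → ι) : sumAlgEquiv R {i // P i} {i // ¬ P i}
      (rename (Equiv.sumCompl P).symm (∏ i, X (f i))) =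
        monomial (exponent (headIndex P ∘ f)).some (∏ i, tailFactor X (f i)) := by
    simp only [map_prod, sumAlgEquiv_rename_X, exponent_some_eq_sum, Function.comp_apply,
      monomial_sum_prod]
  have hvec (f : κ → ι) (α : κ → Option {i // P i}) : ∏ i, patternVector x (α i) (f i) =
      if headIndex P ∘ f = α then ∏ i, tailFactor x (f i) else 0 := by
    simp only [patternVector, prod_ite_zero, mem_univ, true_imp_iff, funext_iff,
      Function.comp_apply]
  have hcoeff (f : κ → ι) : eval x ((sumAlgEquiv R {i // P i} {i // ¬ P i}
      (rename (Equiv.sumCompl P).symm (C (T.entry f) * ∏ i, X (f i)))).coeff μ) =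
        if (exponent (headIndex P ∘ f)).some = μ then T.entry f * ∏ i, tailFactor x (f i)
        else 0 := by
    rw [C_mul', map_smul, map_smul, hpoly, coeff_smul, smul_eval, coeff_monomial,
      apply_ite (eval x), mul_ite, map_prod, map_zero, mul_zero]
    simp only [eval_tailFactor_X]
  calc _ = ∑ f : κ → ι, if (exponent (headIndex P ∘ f)).some = μ then
          T.entry f * ∏ i, tailFactor x (f i) else 0 := by
        simp only [toPoly, map_sum, coeff_sum, hcoeff]
    _ = ∑ f, ∑ α with (exponent α).some = μ, T.entry f * ∏ i, patternVector x (α i) (f i) := by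
        simp [hvec]
    _ = _ := by
        rw [sum_comm]
        simp only [apply_eq_sum_entry]

theorem patternVector_some [Zero R] [One R] (x : {j // ¬ P j} → R)
    (a : {i // P i}) : patternVector x (some a) = Pi.single (a : ι) 1 := by
  funext j
  by_cases hj : P j
  · simp [patternVector, headIndex, tailFactor, Pi.single_apply, hj, Subtype.ext_iff]
  · have hja : j ≠ a := fun h => hj (h ▸ a.2)
    simp [patternVector, headIndex, hj, hja]

theorem patternVector_none [Zero R] [One R] (x : {j // ¬ P j} → R) :
    patternVector x none = Function.extend Subtype.val x 0 := by
  rw [← extend_val_eq_self (P := (¬ P ·)) (v := patternVector x none) fun j hj => by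
    simp [patternVector, headIndex, not_not.1 hj]]
  congr 1
  funext j
  simp [patternVector, headIndex, tailFactor, j.2]

variable [Fintype ι] [CommSemiring R]

theorem patternVector_dotProduct_of_ne (x y : {j // ¬ P j} → R) {o o' : Option {i // P i}}
    (h : o ≠ o') : patternVector x o ⬝ᵥ patternVector y o' = 0 := by
  refine sum_eq_zero fun j _ => ?_
  unfold patternVector
  split_ifs with ho ho' <;> simp_all

theorem patternVector_dotProduct_self {x : {j // ¬ P j} → R} (hx : x ⬝ᵥ x = 1)
    (o : Option {i // P i}) : patternVector x o ⬝ᵥ patternVector x o = 1 := by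
  cases o with
  | none =>
    rw [patternVector_none, extend_val_dotProduct]
    simpa only [Subtype.val_injective.extend_apply] using hx
  | some a => rw [patternVector_some, single_dotProduct, Pi.single_eq_same, one_mul]

theorem prod_patternVector_dotProduct [Fintype κ] {α β : κ → Option {i // P i}}
    {x : (κ → Option {i // P i}) → {j // ¬ P j} → R} (hx : ∀ α, x α ⬝ᵥ x α = 1) :
    ∏ i, patternVector (x α) (α i) ⬝ᵥ patternVector (x β) (β i) = if α = β then 1 else 0 := by
  split_ifs with h
  · subst h
    exact prod_eq_one fun i _ => patternVector_dotProduct_self (hx α) (α i)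
  · -- The supports are disjoint in slot `i`, whatever `x α` and `x β` are.
    obtain ⟨i, hi⟩ := Function.ne_iff.1 h
    exact prod_eq_zero (mem_univ i) (patternVector_dotProduct_of_ne _ _ hi)

end PatternVector

section EnergyIncrement

open MultilinearForm

theorem exists_orthogonal_transpose_mulVec_eq_zero {n : ℕ} {α : Type*} [Fintype α]
    (w : α → Fin n → ℝ) :
    ∃ U ∈ Matrix.orthogonalGroup (Fin n) ℝ,
      ∀ a (j : Fin n), Fintype.card α ≤ j → (Uᵀ *ᵥ w a) j = 0 := by
  let f (i : Fin n) : EuclideanSpace ℝ (Fin n) :=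
    if hi : (i : ℕ) < Fintype.card α then
      WithLp.toLp 2 (w ((Fintype.equivFin α).symm ⟨i, hi⟩)) else 0
  have hdim : Module.finrank ℝ (EuclideanSpace ℝ (Fin n)) = Fintype.card (Fin n) :=
    finrank_euclideanSpace
  let b := InnerProductSpace.gramSchmidtOrthonormalBasis hdim f
  refine ⟨(EuclideanSpace.basisFun (Fin n) ℝ).toBasis.toMatrix b,
    OrthonormalBasis.toMatrix_orthonormalBasis_mem_orthogonal _ b, fun a j hj => ?_⟩
  have hij : (Fintype.equivFin α a : ℕ) < j := (Fintype.equivFin α a).2.trans_le hj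
  have hperp := InnerProductSpace.gramSchmidtOrthonormalBasis_inv_triangular hdim f
    (i := ⟨Fintype.equivFin α a, hij.trans j.2⟩) hij
  simpa [f, PiLp.inner_apply, Matrix.mulVec, dotProduct, Module.Basis.toMatrix_apply, mul_comm]
    using hperp

theorem MultilinearForm.energy_add_sum_sq_patternVector_le {κ ι : Type*} [Fintype κ]
    [DecidableEq κ] [Fintype ι] [DecidableEq ι] (T : MultilinearForm ℝ κ ι) {P P' : ι → Prop}
    [DecidablePred P] [DecidablePred P'] {x : (κ → Option {i // P i}) → {j // ¬ P j} → ℝ}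
    (hx : ∀ α, x α ⬝ᵥ x α = 1) {U : Matrix ι ι ℝ} (hU : U ∈ Matrix.orthogonalGroup ι ℝ)
    (hUx : ∀ α i j, ¬ P' j → (Uᵀ *ᵥ patternVector (x α) (α i)) j = 0) :
    T.energy P + ∑ α with exponent α none ≠ 0, T (fun i => patternVector (x α) (α i)) ^ 2 ≤
      (T.comp U.mulVecLin).energy P' := by
  calc T.energy P + ∑ α with exponent α none ≠ 0, T (fun i => patternVector (x α) (α i)) ^ 2
      = ∑ α, T (fun i => patternVector (x α) (α i)) ^ 2 := by
        rw [← sum_comp_some_add_sum_exponent_none_ne_zero]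
        simp only [energy, entry, Function.comp_apply, patternVector_some]
    _ = ∑ α, T.comp U.mulVecLin (fun i => Uᵀ *ᵥ patternVector (x α) (α i)) ^ 2 := by
        simp only [T.comp_mulVecLin_apply_transpose_mulVec hU]
    _ ≤ (T.comp U.mulVecLin).energy P' := sum_sq_apply_le_energy _ hUx fun α β => by
        simp only [mulVec_dotProduct_mulVec_of_mem_orthogonalGroup
          (transpose_mem_orthogonalGroup hU)]
        exact prod_patternVector_dotProduct hx

theorem exists_sphereMaxSq_le_eval_sq {ι : Type} [Fintype ι] [Nonempty ι] (q : MvPolynomial ι ℝ) :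
    ∃ x : ι → ℝ, x ⬝ᵥ x = 1 ∧ sphereMaxSq q ≤ eval x q ^ 2 := by
  have hne : (Metric.sphere (0 : EuclideanSpace ℝ ι) 1).Nonempty :=
    NormedSpace.sphere_nonempty.2 zero_le_one
  have hcont : Continuous fun y : EuclideanSpace ℝ ι => eval (fun i => y i) q ^ 2 :=
    ((MvPolynomial.continuous_eval q).comp (by fun_prop)).pow 2
  obtain ⟨x, hx, hmax⟩ := (isCompact_sphere (0 : EuclideanSpace ℝ ι) 1).exists_isMaxOn hne
    hcont.continuousOn
  have := hne.to_subtype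
  refine ⟨fun i => x i, ?_, ciSup_le fun y => hmax y.2⟩
  rw [dotProduct, ← one_pow 2, ← mem_sphere_zero_iff_norm.1 hx, EuclideanSpace.real_norm_sq_eq]
  simp only [sq]

theorem sphereMaxSq_of_isEmpty {ι : Type} [Fintype ι] [IsEmpty ι] (q : MvPolynomial ι ℝ) :
    sphereMaxSq q = 0 := by
  have : IsEmpty (Metric.sphere (0 : EuclideanSpace ℝ ι) 1) :=
    ⟨fun x => by simpa [Subsingleton.elim x.1 0] using x.2⟩
  exact Real.iSup_of_isEmpty _

theorem card_firstVars_le (n k : ℕ) : Fintype.card (FirstVars n k) ≤ k := by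
  simpa using Fintype.card_le_of_injective (fun i : FirstVars n k => (⟨i.1, i.2⟩ : Fin k))
    fun i j h => Subtype.ext (Fin.ext (Fin.mk.inj h))

variable {d n : ℕ}

theorem MultilinearForm.IsSymm.frobeniusSq_le_coeffNorm_sq {T : MultilinearForm ℝ (Fin d) (Fin n)}
    (hT : T.IsSymm) : T.frobeniusSq ≤ coeffNorm T.toPoly ^ 2 := by
  rw [coeffNorm, Real.sq_sqrt (sum_nonneg fun _ _ => sq_nonneg _)]
  exact hT.frobeniusSq_le

theorem sum_sphereMaxSq_partCoeff_toPoly_le {k : ℕ} (T : MultilinearForm ℝ (Fin d) (Fin n))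
    {x : (FirstVars n k →₀ ℕ) → LastVars n k → ℝ}
    (hx : ∀ μ, sphereMaxSq (partCoeff k T.toPoly μ) ≤ eval (x μ) (partCoeff k T.toPoly μ) ^ 2) :
    ∑ j ∈ range d, ∑ μ ∈ finsuppAntidiag (univ : Finset (FirstVars n k)) j,
        sphereMaxSq (partCoeff k T.toPoly μ) ≤
      (d + 1) ^ d * ∑ α : Fin d → Option (FirstVars n k) with exponent α none ≠ 0,
        T (fun i => patternVector (x (exponent α).some) (α i)) ^ 2 := by
  have hμ (μ : FirstVars n k →₀ ℕ) : sphereMaxSq (partCoeff k T.toPoly μ) ≤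
      (∑ α with (exponent α).some = μ,
        T fun i => patternVector (x (exponent α).some) (α i)) ^ 2 := by
    refine (hx μ).trans_eq (congrArg (· ^ 2) ?_)
    refine (eval_coeff_sumAlgEquiv_rename_toPoly T μ (x μ)).trans (sum_congr rfl fun α hα => ?_)
    rw [(mem_filter.1 hα).2]
  refine (sum_le_sum fun j _ => sum_le_sum fun μ _ => hμ μ).trans ?_
  simpa only [Fintype.card_fin] using sum_sq_sum_exponent_some_le
    fun α : Fin d → Option (FirstVars n k) =>
      T fun i => patternVector (x (exponent α).some) (α i)

theorem exists_energy_increment {T : MultilinearForm ℝ (Fin d) (Fin n)} (hT : T.IsSymm) {ε : ℝ}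
    (hε : 0 ≤ ε) {k : ℕ} (h : ¬ IsConcentrated ε d k T.toPoly) :
    ∃ U ∈ Matrix.orthogonalGroup (Fin n) ℝ, ∃ k' ≤ n, k' ≤ (k + 1) ^ d * d ∧
      T.energy (·.val < k) + ε / (d + 1) ^ d * T.frobeniusSq <
        (T.comp U.mulVecLin).energy (·.val < k') := by
  rw [IsConcentrated, not_le] at h
  have hlt := (mul_le_mul_of_nonneg_left hT.frobeniusSq_le_coeffNorm_sq hε).trans_lt h
  rcases isEmpty_or_nonempty (LastVars n k) with hk | hk
  · simp only [sphereMaxSq_of_isEmpty, sum_const_zero] at hlt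
    exact absurd hlt (mul_nonneg hε (frobeniusSq_nonneg T)).not_gt
  choose x hx hmax using fun μ => exists_sphereMaxSq_le_eval_sq (partCoeff k T.toPoly μ)
  obtain ⟨U, hU, hsupp⟩ := exists_orthogonal_transpose_mulVec_eq_zero
    fun a : (Fin d → Option (FirstVars n k)) × Fin d =>
      patternVector (x (exponent a.1).some) (a.1 a.2)
  simp only [Fintype.card_prod, Fintype.card_fun, Fintype.card_option, Fintype.card_fin] at hsupp
  refine ⟨U, hU, min n ((Fintype.card (FirstVars n k) + 1) ^ d * d), min_le_left _ _,
    (min_le_right _ _).trans (by gcongr; exact card_firstVars_le n k), ?_⟩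
  refine lt_of_lt_of_le ?_ (energy_add_sum_sq_patternVector_le T
    (fun α => hx (exponent α).some) hU fun α i j hj => hsupp (α, i) j
      (by simpa [lt_min_iff, j.2] using hj))
  rw [div_mul_eq_mul_div]
  gcongr
  rw [div_lt_iff₀' (by positivity)]
  exact hlt.trans_le (sum_sphereMaxSq_partCoeff_toPoly_le T hmax)

theorem exists_isConcentrated_comp {T : MultilinearForm ℝ (Fin d) (Fin n)} (hT : T.IsSymm) {ε : ℝ}
    (hε : 0 ≤ ε) {N : ℕ} (hN : (d + 1) ^ d ≤ N * ε) :
    ∃ U ∈ Matrix.orthogonalGroup (Fin n) ℝ, ∃ k ≤ n,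
      (∃ i ≤ N, k ≤ (fun k => (k + 1) ^ d * d)^[i] 0) ∧
        IsConcentrated ε d k (T.comp U.mulVecLin).toPoly := by
  let rotate (U : Matrix.orthogonalGroup (Fin n) ℝ) := T.comp U.1.mulVecLin
  have hnorm (U) : (rotate U).frobeniusSq = T.frobeniusSq := frobeniusSq_comp_mulVecLin T U.2
  have hstep (s : Matrix.orthogonalGroup (Fin n) ℝ × Fin (n + 1))
      (hs : ¬ IsConcentrated ε d s.2 (rotate s.1).toPoly) :
      ∃ t : Matrix.orthogonalGroup (Fin n) ℝ × Fin (n + 1), (t.2 : ℕ) ≤ (s.2 + 1) ^ d * d ∧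
        (rotate s.1).energy (·.val < s.2.val) + ε / (d + 1) ^ d * T.frobeniusSq <
          (rotate t.1).energy (·.val < t.2.val) := by
    obtain ⟨V, hV, k', hk'n, hk', hlt⟩ := exists_energy_increment (hT.comp _) hε hs
    refine ⟨(s.1 * ⟨V, hV⟩, ⟨k', Nat.lt_succ_of_le hk'n⟩), hk', ?_⟩
    have hmul : rotate (s.1 * ⟨V, hV⟩) = (rotate s.1).comp V.mulVecLin :=
      congrArg T.comp (Matrix.mulVecLin_mul s.1.1 V)
    rwa [← hnorm s.1, hmul]
  have hstart : T.frobeniusSq ≤ (rotate 1).energy (·.val < 0) +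
      (N + 1) * (ε / (d + 1) ^ d * T.frobeniusSq) := by
    have hN' : 1 ≤ (N + 1) * (ε / (d + 1) ^ d) := by
      rw [mul_div_assoc', le_div_iff₀ (by positivity)]
      linarith
    rw [← mul_assoc]
    exact (le_mul_of_one_le_left (frobeniusSq_nonneg T) hN').trans
      (le_add_of_nonneg_left (energy_nonneg _ _))
  obtain ⟨⟨U, k⟩, hconc, hk⟩ := exists_iterate_of_energy_increment
    (good := fun s : Matrix.orthogonalGroup (Fin n) ℝ × Fin (n + 1) =>
      IsConcentrated ε d s.2 (rotate s.1).toPoly)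
    (g := fun k => (k + 1) ^ d * d) (fun a b hab => by dsimp only; gcongr)
    (fun s => (energy_le_frobeniusSq _ _).trans_eq (hnorm s.1)) hstep N (1, 0) hstart
  exact ⟨U, U.2, k, Nat.le_of_lt_succ k.2, hk, hconc⟩

end EnergyIncrement

end PolyConc

theorem mainTheorem4 :
    ∀ (ε : ℝ), 0 < ε → ∀ (d : ℕ), ∃ K : ℕ, ∀ (n : ℕ) (p : MvPolynomial (Fin n) ℝ),
      p.IsHomogeneous d →
        ∃ U ∈ Matrix.orthogonalGroup (Fin n) ℝ, ∃ k : ℕ, k ≤ n ∧ k ≤ K ∧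
          PolyConc.IsConcentrated ε d k (PolyConc.linSubst U p) := by
  intro ε hε d
  obtain ⟨N, hN⟩ := exists_nat_ge (((d : ℝ) + 1) ^ d / ε)
  refine ⟨(Finset.range (N + 1)).sup fun i => (fun k => (k + 1) ^ d * d)^[i] 0, fun n p hp => ?_⟩
  obtain ⟨T, hT, rfl⟩ := PolyConc.MultilinearForm.exists_isSymm_toPoly_eq (κ := Fin d) (p := p)
    (by rwa [Fintype.card_fin])
  obtain ⟨U, hU, k, hkn, ⟨i, hi, hk⟩, hconc⟩ :=
    PolyConc.exists_isConcentrated_comp hT hε.le ((div_le_iff₀ hε).1 hN)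
  refine ⟨U, hU, k, hkn, hk.trans (Finset.le_sup (f := fun i => (fun k => (k + 1) ^ d * d)^[i] 0)
    (Finset.mem_range_succ_iff.2 hi)), ?_⟩
  rwa [PolyConc.linSubst, PolyConc.MultilinearForm.aeval_mulVec_toPoly]
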